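/- Let $\mathrm{PVAR}$ be a set of program variables and $\mathrm{LOC}$ an infinite set of locations. A memory state is a pair $(s,h)$ of a store $s:\mathrm{PVAR}\to\mathrm{LOC}$ and a heap $h:\mathrm{LOC}\rightharpoonup_{\mathrm{fin}}\mathrm{LOC}$, a partial function with finite domain $\mathrm{dom}(h)$. The formulae of $\mathrm{SL}(*,\mathtt{reach}^+)$ are $$\varphi ::= x=y \mid x\hookrightarrow y \mid \mathtt{reach}^+(x,y)\mid \mathtt{emp}\mid \neg\varphi\mid\varphi\wedge\varphi\mid\varphi*\varphi ,\qquad x,y\in\mathrm{PVAR},$$ with the following semantics: $(s,h)\models x=y$ iff $s(x)=s(y)$; $(s,h)\models x\hookrightarrow y$ iff $s(x)\in\mathrm{dom}(h)$ and $h(s(x))=s(y)$; $(s,h)\models\mathtt{reach}^+(x,y)$ iff $h^i(s(x))=s(y)$ for some $i\ge 1$ (where $h^i$ is the $i$-fold composition of the partial function $h$); $(s,h)\models\mathtt{emp}$ iff $\mathrm{dom}(h)=\emptyset$; $\neg$ and $\wedge$ are classical; and $(s,h)\models\varphi_1*\varphi_2$ iff $h$ is the union of two heaps $h_1,h_2$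 with disjoint domains such that $(s,h_1)\models\varphi_1$ and $(s,h_2)\models\varphi_2$. Let $|\varphi|$ be the tree size of $\varphi$, i.e. the number of nodes of its syntax tree, whose leaves are the atomic formulae. Theorem. Let $q\ge 0$ and let $\varphi$ be a formula of $\mathrm{SL}(*,\mathtt{reach}^+)$ built over the variables $x_1,\dots,x_q$. If $\varphi$ is satisfiable (some memory state satisfies it), then there is a memory state $(s,h)$ such that $(s,h)\models\varphi$ and $$\mathrm{card}(\mathrm{dom}(h))\le (q^2+q)(|\varphi|+1)+|\varphi| .$$ -/

import Mathlib

namespace SepLogic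

/-- A heap over the locations `Loc`: a partial function from `Loc` to `Loc` with finite domain. -/
@[ext]
structure Heap (Loc : Type*) where
  /-- `toFun l = some l'` means that `l` is allocated and points to `l'`. -/
  toFun : Loc → Option Loc
  finite_dom : {l | toFun l ≠ none}.Finite

namespace Heap

variable {Loc : Type*}

/-- The domain of a heap: its finite set of memory cells. -/
noncomputable def dom (h : Heap Loc) : Finset Loc := h.finite_dom.toFinset

/-- Two heaps are disjoint when their domains are. -/
def Disj (h₁ h₂ : Heap Loc) : Prop := Disjoint h₁.dom h₂.dom

/-- The union of two heaps (used for disjoint heaps only). -/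
def union (h₁ h₂ : Heap Loc) : Heap Loc where
  toFun l := (h₁.toFun l).or (h₂.toFun l)
  finite_dom := (h₁.finite_dom.union h₂.finite_dom).subset fun l hl => by
    by_contra hc
    simp only [Set.mem_union, Set.mem_ofPred_eq, not_or, not_not] at hc
    exact hl (by simp [hc.1, hc.2])

/-- The iterates of a heap as a partial function: `h.iter 0` is the identity, and
`h.iter (i + 1) l` is `h (h.iter i l)` if this is defined, and undefined otherwise. -/
def iter (h : Heap Loc) : ℕ → Loc → Option Loc
  | 0, l => some l
  | i + 1, l => (h.iter i l).bind h.toFun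

end Heap

/-- The formulae of `SL(∗, reach⁺)` over the program variables `PVar`. -/
inductive Formula (PVar : Type*) where
  /-- `x = y` -/
  | eq (x y : PVar) : Formula PVar
  /-- `x ↪ y` -/
  | pointsTo (x y : PVar) : Formula PVar
  /-- `reach⁺(x, y)` -/
  | reachPlus (x y : PVar) : Formula PVar
  /-- `emp` -/
  | emp : Formula PVar
  /-- `¬ φ` -/
  | neg (φ : Formula PVar) : Formula PVar
  /-- `φ ∧ ψ` -/
  | and (φ ψ : Formula PVar) : Formula PVar
  /-- `φ ∗ ψ` -/
  | sep (φ ψ : Formula PVar) : Formula PVar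

namespace Formula

variable {PVar Loc : Type*}

/-- The set of program variables that occur in a formula. -/
def vars : Formula PVar → Set PVar
  | eq x y => {x, y}
  | pointsTo x y => {x, y}
  | reachPlus x y => {x, y}
  | emp => ∅
  | neg φ => φ.vars
  | and φ ψ => φ.vars ∪ ψ.vars
  | sep φ ψ => φ.vars ∪ ψ.vars

/-- The tree size of a formula: the number of nodes of its syntax tree, whose leaves are the
atomic formulae. -/
def size : Formula PVar → ℕ
  | eq _ _ => 1
  | pointsTo _ _ => 1
  | reachPlus _ _ => 1
  | emp => 1
  | neg φ => φ.size + 1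
  | and φ ψ => φ.size + ψ.size + 1
  | sep φ ψ => φ.size + ψ.size + 1

/-- The satisfaction relation: `Sat s h φ` says that the memory state with store `s` and heap `h`
satisfies `φ`. -/
def Sat (s : PVar → Loc) : Heap Loc → Formula PVar → Prop
  | _, eq x y => s x = s y
  | h, pointsTo x y => h.toFun (s x) = some (s y)
  | h, reachPlus x y => ∃ i : ℕ, 1 ≤ i ∧ h.iter i (s x) = some (s y)
  | h, emp => h.dom = ∅
  | h, neg φ => ¬ Sat s h φ
  | h, and φ ψ => Sat s h φ ∧ Sat s h ψ
  | h, sep φ ψ => ∃ h₁ h₂ : Heap Loc, h₁.Disj h₂ ∧ h₁.union h₂ = h ∧ Sat s h₁ φ ∧ Sat s h₂ ψ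

/-- A formula is satisfiable (over the locations `Loc`) if some memory state satisfies it. -/
def Satisfiable (Loc : Type*) (φ : Formula PVar) : Prop :=
  ∃ (s : PVar → Loc) (h : Heap Loc), Sat s h φ

end Formula

end SepLogic

/-! The argument is of Ehrenfeucht–Fraïssé type. Let `V` be the set of values of the variables and
`P` the union of `V` with the branch points, where two cells reachable from `V` meet. The parts of
`h` that lead from a location of `P` to the next one are paths with pairwise disjoint cells, a
`Chart`. In any subheap an atomic formula sees only which paths survive whole, which of them have
length one, and whether any cell is left: a path that has lost a cell connects nothing, so its other
cells are as anonymous as those on no path.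

The invariant `BlockEquiv` records exactly this, with path lengths counted up to `α + 1` and
anonymous cells up to `α`. It can be kept when a heap is split, the threshold being divided between
the two halves (`BlockEquiv.exists_split`), so with `α = |φ|` it decides `φ`
(`sat_iff_of_blockEquiv`). Shortening every path to at most `α + 1` cells and keeping at most `α`
other cells respects the invariant (`Chart.exists_small`) and leaves at most `card P * (α + 1) + α`
cells. Counting predecessors shows that there are no more branch points than elements of `V`, so
`card P ≤ 2q ≤ q² + q`. -/

namespace SepLogic

open scoped Classical

/-! ### Counting up to a threshold, and splitting families of disjoint blocks -/

section Combinatorics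

variable {β : Type*}

/-- Two natural numbers agree up to the threshold `α`. -/
def CapEq (α a b : ℕ) : Prop := min a α = min b α

theorem CapEq.add {α a b a' b' : ℕ} (h : CapEq α a b) (h' : CapEq α a' b') :
    CapEq α (a + a') (b + b') := by
  unfold CapEq at *; omega

theorem CapEq.sum {γ : Type*} {α : ℕ} (F : Finset γ) {f g : γ → ℕ}
    (h : ∀ u ∈ F, CapEq α (f u) (g u)) : CapEq α (∑ u ∈ F, f u) (∑ u ∈ F, g u) := by
  induction F using Finset.induction_on with
  | empty => simp [CapEq]
  | insert a F ha ih =>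
    rw [Finset.sum_insert ha, Finset.sum_insert ha]
    exact (h a (Finset.mem_insert_self _ _)).add
      (ih fun u hu => h u (Finset.mem_insert_of_mem hu))

/-- A part within its threshold is copied exactly and the other takes the rest; if both exceed their
thresholds, `α₁` suffices for the first. Used for the remainder. -/
theorem exists_capEq_split {α₁ α₂ a b n : ℕ} (h : CapEq (α₁ + α₂) (a + b) n) :
    ∃ k ≤ n, CapEq α₁ a k ∧ CapEq α₂ b (n - k) := by
  unfold CapEq at *
  by_cases ha : a ≤ α₁
  · exact ⟨min a n, by omega, by omega, by omega⟩
  · by_cases hb : b ≤ α₂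
    · exact ⟨n - b, by omega, by omega, by omega⟩
    · exact ⟨α₁, by omega, by omega, by omega⟩

/-- Used for a block: emptiness of a part must be preserved too, since it says that the other part
contains the whole block. -/
theorem exists_capEq_split_pos {α₁ α₂ a b n : ℕ} (h₁ : 1 ≤ α₁) (h₂ : 1 ≤ α₂)
    (h : CapEq (α₁ + α₂ + 1) (a + b) n) :
    ∃ k ≤ n, CapEq α₁ a k ∧ CapEq α₂ b (n - k) ∧ (a = 0 ↔ k = 0) ∧ (b = 0 ↔ k = n) := by
  unfold CapEq at *
  by_cases ha : a ≤ α₁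
  · exact ⟨a, by omega, by omega, by omega, by omega, by omega⟩
  · by_cases hb : b ≤ α₂
    · exact ⟨n - b, by omega, by omega, by omega, by omega, by omega⟩
    · exact ⟨α₁, by omega, by omega, by omega, by omega, by omega⟩

/-- The indices in `I` whose block of `A` is contained in `S`. -/
noncomputable def fullBlocks (I : Finset β) (A : β → Finset β) (S : Finset β) : Finset β :=
  I.filter fun u => A u ⊆ S

/-- The elements of `S` that lie in no block contained in `S`. -/
noncomputable def remainder (I : Finset β) (A : β → Finset β) (S : Finset β) : Finset β :=
  S \ (fullBlocks I A S).biUnion A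

/-- `S` and `S'` contain the same blocks, of the same cardinality up to `α + 1`, and
their remainders have the same cardinality up to `α`. -/
structure BlockEquiv (I : Finset β) (A B : β → Finset β) (α : ℕ) (S S' : Finset β) : Prop where
  subset_iff : ∀ u ∈ I, A u ⊆ S ↔ B u ⊆ S'
  card_block : ∀ u ∈ I, A u ⊆ S → CapEq (α + 1) (A u).card (B u).card
  card_remainder : CapEq α (remainder I A S).card (remainder I B S').card

theorem BlockEquiv.symm {I : Finset β} {A B : β → Finset β} {α : ℕ} {S S' : Finset β}
    (h : BlockEquiv I A B α S S') : BlockEquiv I B A α S' S where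
  subset_iff u hu := (h.subset_iff u hu).symm
  card_block u hu hB := (h.card_block u hu ((h.subset_iff u hu).2 hB)).symm
  card_remainder := h.card_remainder.symm

theorem BlockEquiv.mono {I : Finset β} {A B : β → Finset β} {α γ : ℕ} {S S' : Finset β}
    (h : BlockEquiv I A B α S S') (hγ : γ ≤ α) : BlockEquiv I A B γ S S' where
  subset_iff := h.subset_iff
  card_block u hu hA := by
    have := h.card_block u hu hA
    unfold CapEq at *; omega
  card_remainder := by
    have := h.card_remainder
    unfold CapEq at *; omega

/-- Passing to a subset, the remainder gains the surviving elements of every block that gets broken.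
-/
theorem card_remainder_of_subset {I : Finset β} {A : β → Finset β}
    (hA : (I : Set β).PairwiseDisjoint A) {S T : Finset β} (hT : T ⊆ S) :
    (remainder I A T).card = (remainder I A S ∩ T).card +
      ∑ u ∈ fullBlocks I A S, if A u ⊆ T then 0 else (A u ∩ T).card := by
  have key : remainder I A T = (remainder I A S ∩ T) ∪
      (fullBlocks I A S).biUnion fun u => if A u ⊆ T then ∅ else A u ∩ T := by
    ext l
    simp only [remainder, fullBlocks, Finset.mem_sdiff, Finset.mem_biUnion, Finset.mem_filter,
      Finset.mem_union, Finset.mem_inter, not_exists, not_and, and_imp]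
    constructor
    · rintro ⟨hl, hn⟩
      by_cases hex : ∃ u, u ∈ I ∧ A u ⊆ S ∧ l ∈ A u
      · obtain ⟨u, hu, hS, hlu⟩ := hex
        refine Or.inr ⟨u, ⟨hu, hS⟩, ?_⟩
        rw [if_neg fun hc => hn u hu hc hlu]
        exact Finset.mem_inter.2 ⟨hlu, hl⟩
      · push Not at hex
        exact Or.inl ⟨⟨hT hl, hex⟩, hl⟩
    · rintro (⟨⟨_, hn⟩, hl⟩ | ⟨u, ⟨hu, hS⟩, hl⟩)
      · exact ⟨hl, fun u hu hc => hn u hu (hc.trans hT)⟩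
      · split_ifs at hl with hc
        · simp at hl
        · rw [Finset.mem_inter] at hl
          refine ⟨hl.2, fun v hv hvT hlv => ?_⟩
          have : u = v := by
            by_contra hne
            exact Finset.disjoint_left.1 (hA hu hv hne) hl.1 hlv
          exact hc (this ▸ hvT)
  rw [key, Finset.card_union_of_disjoint, Finset.card_biUnion]
  · congr 1
    refine Finset.sum_congr rfl fun u _ => ?_
    split_ifs <;> simp
  · intro u hu v hv hne
    have := hA (Finset.mem_filter.1 hu).1 (Finset.mem_filter.1 hv).1 hne
    have hsub : ∀ w, (if A w ⊆ T then ∅ else A w ∩ T) ⊆ A w := fun w => by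
      split_ifs <;> simp [Finset.inter_subset_left]
    exact Finset.disjoint_of_subset_left (hsub u) (Finset.disjoint_of_subset_right (hsub v) this)
  · rw [Finset.disjoint_left]
    intro l hl hl'
    obtain ⟨u, hu, hlu⟩ := Finset.mem_biUnion.1 hl'
    split_ifs at hlu with hc
    · simp at hlu
    · exact (Finset.mem_sdiff.1 (Finset.mem_inter.1 hl).1).2
        (Finset.mem_biUnion.2 ⟨u, hu, (Finset.mem_inter.1 hlu).1⟩)

theorem BlockEquiv.of_subset {I : Finset β} {A B : β → Finset β}
    (hA : (I : Set β).PairwiseDisjoint A) (hB : (I : Set β).PairwiseDisjoint B)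
    {α γ : ℕ} {S S' T T' : Finset β} (h : BlockEquiv I A B γ S S') (hαγ : α ≤ γ)
    (hT : T ⊆ S) (hT' : T' ⊆ S')
    (hfull : ∀ u ∈ I, A u ⊆ S → (A u ⊆ T ↔ B u ⊆ T'))
    (hcard : ∀ u ∈ I, A u ⊆ S → CapEq α (A u ∩ T).card (B u ∩ T').card)
    (hrem : CapEq α (remainder I A S ∩ T).card (remainder I B S' ∩ T').card) :
    BlockEquiv I A B α T T' where
  subset_iff u hu := by
    by_cases hS : A u ⊆ S
    · exact hfull u hu hS
    · exact ⟨fun hc => absurd (hc.trans hT) hS,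
        fun hc => absurd ((h.subset_iff u hu).2 (hc.trans hT')) hS⟩
  card_block u hu hc := (h.mono hαγ).card_block u hu (hc.trans hT)
  card_remainder := by
    have hF : fullBlocks I B S' = fullBlocks I A S :=
      Finset.filter_congr fun u hu => (h.subset_iff u hu).symm
    rw [card_remainder_of_subset hA hT, card_remainder_of_subset hB hT', hF]
    refine hrem.add (CapEq.sum _ fun u hu => ?_)
    obtain ⟨hu, hS⟩ := Finset.mem_filter.1 hu
    have h1 := hfull u hu hS
    have h2 := hcard u hu hS
    by_cases hc : A u ⊆ T
    · rw [if_pos hc, if_pos (h1.1 hc)]; rfl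
    · rwa [if_neg hc, if_neg (mt h1.2 hc)]

theorem card_inter_eq_zero_iff_subset {C T U : Finset β} (hC : C ⊆ T ∪ U) (hd : Disjoint T U) :
    (C ∩ U).card = 0 ↔ C ⊆ T := by
  rw [Finset.card_eq_zero, ← Finset.disjoint_iff_inter_eq_empty]
  constructor
  · intro h l hl
    exact (Finset.mem_union.1 (hC hl)).resolve_right (Finset.disjoint_left.1 h hl)
  · exact fun h => Finset.disjoint_of_subset_left h hd

theorem card_inter_add_card_inter {C T U : Finset β} (hC : C ⊆ T ∪ U) (hd : Disjoint T U) :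
    (C ∩ T).card + (C ∩ U).card = C.card := by
  rw [← Finset.card_union_of_disjoint, ← Finset.inter_union_distrib_left,
    Finset.inter_eq_left.2 hC]
  exact Finset.disjoint_of_subset_left Finset.inter_subset_right
    (Finset.disjoint_of_subset_right Finset.inter_subset_right hd)

/-- Duplicator's answer to a separating conjunction: each full block and the remainder are split
independently, matching cardinalities. Which elements of a block are taken is irrelevant, only how
many. -/
theorem BlockEquiv.exists_split {I : Finset β} {A B : β → Finset β}
    (hA : (I : Set β).PairwiseDisjoint A) (hB : (I : Set β).PairwiseDisjoint B)
    {α₁ α₂ : ℕ} (h₁ : 1 ≤ α₁) (h₂ : 1 ≤ α₂) {S₁ S₂ S' : Finset β} (hd : Disjoint S₁ S₂)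
    (h : BlockEquiv I A B (α₁ + α₂) (S₁ ∪ S₂) S') :
    ∃ T₁ T₂, Disjoint T₁ T₂ ∧ T₁ ∪ T₂ = S' ∧
      BlockEquiv I A B α₁ S₁ T₁ ∧ BlockEquiv I A B α₂ S₂ T₂ := by
  have hblock : ∀ u, ∃ C ⊆ B u, u ∈ I → A u ⊆ S₁ ∪ S₂ →
      CapEq α₁ (A u ∩ S₁).card C.card ∧ CapEq α₂ (A u ∩ S₂).card ((B u).card - C.card) ∧
      ((A u ∩ S₁).card = 0 ↔ C.card = 0) ∧ ((A u ∩ S₂).card = 0 ↔ C.card = (B u).card) := by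
    intro u
    by_cases hu : u ∈ I ∧ A u ⊆ S₁ ∪ S₂
    · have hc := h.card_block u hu.1 hu.2
      rw [← card_inter_add_card_inter hu.2 hd] at hc
      obtain ⟨k, hk, hk'⟩ := exists_capEq_split_pos h₁ h₂ hc
      obtain ⟨C, hC, rfl⟩ := Finset.exists_subset_card_eq hk
      exact ⟨C, hC, fun _ _ => hk'⟩
    · exact ⟨∅, by simp, fun h1 h2 => absurd ⟨h1, h2⟩ hu⟩
  choose C hCB hC using hblock
  obtain ⟨D, hD, hD₁, hD₂⟩ : ∃ D ⊆ remainder I B S',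
      CapEq α₁ (remainder I A (S₁ ∪ S₂) ∩ S₁).card D.card ∧
      CapEq α₂ (remainder I A (S₁ ∪ S₂) ∩ S₂).card ((remainder I B S').card - D.card) := by
    have hc := h.card_remainder
    rw [← card_inter_add_card_inter (C := remainder I A (S₁ ∪ S₂)) Finset.sdiff_subset hd] at hc
    obtain ⟨k, hk, hk'⟩ := exists_capEq_split hc
    obtain ⟨D, hD, rfl⟩ := Finset.exists_subset_card_eq hk
    exact ⟨D, hD, hk'⟩
  have hrem : ∀ u ∈ I, B u ⊆ S' → ∀ l ∈ B u, l ∉ remainder I B S' := fun u hu hS l hl hr =>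
    (Finset.mem_sdiff.1 hr).2 (Finset.mem_biUnion.2 ⟨u, Finset.mem_filter.2 ⟨hu, hS⟩, hl⟩)
  set T := D ∪ (fullBlocks I B S').biUnion C with hT
  have hTS : T ⊆ S' := by
    refine Finset.union_subset (hD.trans Finset.sdiff_subset) (Finset.biUnion_subset.2 ?_)
    exact fun u hu => (hCB u).trans (Finset.mem_filter.1 hu).2
  have hBT : ∀ u ∈ I, B u ⊆ S' → B u ∩ T = C u := by
    intro u hu hS
    ext l
    simp only [hT, Finset.mem_inter, Finset.mem_union, Finset.mem_biUnion]
    constructor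
    · rintro ⟨hl, hl' | ⟨v, hv, hl'⟩⟩
      · exact absurd (hD hl') (hrem u hu hS l hl)
      · have : u = v := by
          by_contra hne
          exact Finset.disjoint_left.1 (hB hu (Finset.mem_filter.1 hv).1 hne) hl (hCB v hl')
        exact this ▸ hl'
    · exact fun hl => ⟨hCB u hl, Or.inr ⟨u, Finset.mem_filter.2 ⟨hu, hS⟩, hl⟩⟩
  have hDT : remainder I B S' ∩ T = D := by
    ext l
    simp only [hT, Finset.mem_inter, Finset.mem_union, Finset.mem_biUnion]
    constructor
    · rintro ⟨hl, hl' | ⟨v, hv, hl'⟩⟩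
      · exact hl'
      · obtain ⟨hvI, hvS⟩ := Finset.mem_filter.1 hv
        exact absurd hl (hrem v hvI hvS l (hCB v hl'))
    · exact fun hl => ⟨hD hl, Or.inl hl⟩
  have hdT : Disjoint T (S' \ T) := Finset.disjoint_sdiff
  have hTU : T ∪ S' \ T = S' := Finset.union_sdiff_of_subset hTS
  -- The second half is the complement of `T`, so its cardinalities are differences.
  have hcardT : ∀ {E : Finset β}, E ⊆ S' →
      (E ∩ (S' \ T)).card = E.card - (E ∩ T).card := by
    intro E hE
    have := card_inter_add_card_inter (hE.trans hTU.ge) hdT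
    omega
  refine ⟨T, S' \ T, hdT, hTU, ?_, ?_⟩
  · refine h.of_subset hA hB (by omega) Finset.subset_union_left hTS ?_ ?_ ?_
    · intro u hu hS
      have hS' := (h.subset_iff u hu).1 hS
      obtain ⟨-, -, -, hc⟩ := hC u hu hS
      rw [← card_inter_eq_zero_iff_subset hS hd, hc,
        ← card_inter_eq_zero_iff_subset (hS'.trans hTU.ge) hdT, hcardT hS', hBT u hu hS']
      have := Finset.card_le_card (hCB u)
      omega
    · intro u hu hS
      rw [hBT u hu ((h.subset_iff u hu).1 hS)]
      exact (hC u hu hS).1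
    · rwa [hDT]
  · refine h.of_subset hA hB (by omega) Finset.subset_union_right Finset.sdiff_subset ?_ ?_ ?_
    · intro u hu hS
      have hS' := (h.subset_iff u hu).1 hS
      obtain ⟨-, -, hc, -⟩ := hC u hu hS
      rw [← card_inter_eq_zero_iff_subset (by rwa [Finset.union_comm]) hd.symm, hc,
        ← card_inter_eq_zero_iff_subset (U := T) (T := S' \ T)
          (by rw [Finset.union_comm]; exact hS'.trans hTU.ge) hdT.symm, hBT u hu hS']
    · intro u hu hS
      have hS' := (h.subset_iff u hu).1 hS
      rw [hcardT hS', hBT u hu hS']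
      exact (hC u hu hS).2.1
    · rwa [hcardT (E := remainder I B S') Finset.sdiff_subset, hDT]

theorem subset_or_card_remainder_ne_zero {I : Finset β} {A : β → Finset β} {S : Finset β}
    (hS : S.Nonempty) : (∃ u ∈ I, A u ⊆ S) ∨ (remainder I A S).card ≠ 0 := by
  by_cases hex : ∃ u ∈ I, A u ⊆ S
  · exact Or.inl hex
  · refine Or.inr ?_
    have : fullBlocks I A S = ∅ := Finset.filter_eq_empty_iff.2 fun u hu hc => hex ⟨u, hu, hc⟩
    simpa [remainder, this] using hS.ne_empty

theorem BlockEquiv.eq_empty {I : Finset β} {A B : β → Finset β} {α : ℕ} (hα : 1 ≤ α)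
    {S' : Finset β} (hA : ∀ u ∈ I, (A u).Nonempty) (h : BlockEquiv I A B α ∅ S') : S' = ∅ := by
  by_contra hne
  rcases subset_or_card_remainder_ne_zero (I := I) (A := B) (Finset.nonempty_iff_ne_empty.2 hne) with
    ⟨u, hu, hB⟩ | hr
  · exact (hA u hu).ne_empty (Finset.subset_empty.1 ((h.subset_iff u hu).2 hB))
  · have := h.card_remainder
    simp only [remainder, Finset.empty_sdiff, Finset.card_empty, CapEq] at this hr
    omega

end Combinatorics

/-! ### Subheaps, and charts of paths between marked locations -/

namespace Heap

variable {Loc : Type*}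

theorem mem_dom {h : Heap Loc} {l : Loc} : l ∈ h.dom ↔ h.toFun l ≠ none := by
  simp [dom]

/-- The restriction of a heap to the cells in `S`. -/
noncomputable def restrict (h : Heap Loc) (S : Finset Loc) : Heap Loc where
  toFun l := if l ∈ S then h.toFun l else none
  finite_dom := h.finite_dom.subset fun l hl hc => hl (by simp [hc])

theorem restrict_toFun (h : Heap Loc) (S : Finset Loc) (l : Loc) :
    (h.restrict S).toFun l = if l ∈ S then h.toFun l else none := rfl

theorem dom_restrict {h : Heap Loc} {S : Finset Loc} (hS : S ⊆ h.dom) :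
    (h.restrict S).dom = S := by
  ext l
  rw [mem_dom, restrict_toFun]
  by_cases hl : l ∈ S
  · simpa [hl] using mem_dom.1 (hS hl)
  · simp [hl]

theorem restrict_dom (h : Heap Loc) : h.restrict h.dom = h := by
  ext1
  funext l
  rw [restrict_toFun]
  by_cases hl : l ∈ h.dom
  · rw [if_pos hl]
  · rw [if_neg hl]
    exact (not_not.1 (mt mem_dom.2 hl)).symm

/-- All subheaps met while evaluating a formula are thus restrictions of one heap, and splitting
heaps becomes splitting finite sets. -/
theorem union_eq_restrict_iff {h h₁ h₂ : Heap Loc} {S : Finset Loc} (hS : S ⊆ h.dom) :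
    (h₁.Disj h₂ ∧ h₁.union h₂ = h.restrict S) ↔
      ∃ S₁ S₂, Disjoint S₁ S₂ ∧ S₁ ∪ S₂ = S ∧ h₁ = h.restrict S₁ ∧ h₂ = h.restrict S₂ := by
  constructor
  · rintro ⟨hd, hu⟩
    have hu' : ∀ l, (h₁.toFun l).or (h₂.toFun l) = if l ∈ S then h.toFun l else none := fun l =>
      congrFun (congrArg Heap.toFun hu) l
    have hdom : h₁.dom ∪ h₂.dom = S := by
      rw [← dom_restrict hS, ← hu]
      ext l
      rw [Finset.mem_union, mem_dom, mem_dom, mem_dom]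
      simp only [union]
      cases h₁.toFun l <;> simp
    have hsub : ∀ l ∈ S, (h₁.toFun l).or (h₂.toFun l) = h.toFun l := fun l hl => by
      rw [hu' l, if_pos hl]
    refine ⟨h₁.dom, h₂.dom, hd, hdom, ?_, ?_⟩
    · ext1
      funext l
      rw [restrict_toFun]
      by_cases hl : l ∈ h₁.dom
      · rw [if_pos hl, ← hsub l (hdom ▸ Finset.mem_union_left _ hl)]
        have := mem_dom.1 hl
        cases hc : h₁.toFun l <;> simp_all
      · rw [if_neg hl]
        exact not_not.1 (mt mem_dom.2 hl)
    · ext1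
      funext l
      rw [restrict_toFun]
      by_cases hl : l ∈ h₂.dom
      · rw [if_pos hl, ← hsub l (hdom ▸ Finset.mem_union_right _ hl)]
        have hn : h₁.toFun l = none :=
          not_not.1 (mt mem_dom.2 (Finset.disjoint_right.1 hd hl))
        rw [hn, Option.none_or]
      · rw [if_neg hl]
        exact not_not.1 (mt mem_dom.2 hl)
  · rintro ⟨S₁, S₂, hd, rfl, rfl, rfl⟩
    constructor
    · unfold Disj
      rwa [dom_restrict (Finset.union_subset_left hS), dom_restrict (Finset.union_subset_right hS)]
    · ext1
      funext l
      simp only [union, restrict_toFun, Finset.mem_union]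
      by_cases h1 : l ∈ S₁ <;> by_cases h2 : l ∈ S₂ <;> simp [h1, h2]

theorem iter_add (h : Heap Loc) (m n : ℕ) (l : Loc) :
    h.iter (m + n) l = (h.iter m l).bind (h.iter n) := by
  induction n with
  | zero => cases h.iter m l <;> simp [iter]
  | succ n ih =>
    rw [← add_assoc, iter, ih, Option.bind_assoc]
    rfl

theorem iter_one (h : Heap Loc) (l : Loc) : h.iter 1 l = h.toFun l := rfl

theorem iter_eq_some_of_restrict {h : Heap Loc} {S : Finset Loc} {l l' : Loc} {n : ℕ}
    (hn : (h.restrict S).iter n l = some l') : h.iter n l = some l' := by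
  induction n generalizing l' with
  | zero => exact hn
  | succ n ih =>
    obtain ⟨a, ha, ha'⟩ := Option.bind_eq_some_iff.1 hn
    rw [restrict_toFun] at ha'
    split_ifs at ha' with hS
    exact Option.bind_eq_some_iff.2 ⟨a, ih ha, ha'⟩

/-- `Chart h P len c`: each `u ∈ P` is the source of a path `c u 0, …, c u (len u)` of `h` to the
next location in `P`, with `len u = 0` when no location in `P` is reached from `u`, and the
paths of different sources share no cell. -/
structure Chart (h : Heap Loc) (P : Finset Loc) (len : Loc → ℕ) (c : Loc → ℕ → Loc) : Prop where
  zero : ∀ u ∈ P, c u 0 = u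
  step : ∀ u ∈ P, ∀ i < len u, h.toFun (c u i) = some (c u (i + 1))
  last : ∀ u ∈ P, c u (len u) ∈ P
  inner : ∀ u ∈ P, ∀ i < len u, i ≠ 0 → c u i ∉ P
  inj : ∀ u ∈ P, ∀ v ∈ P, ∀ i < len u, ∀ j < len v, c u i = c v j → u = v ∧ i = j
  dead : ∀ u ∈ P, len u = 0 → ∀ n v, h.iter (n + 1) u = some v → v ∉ P

/-- The cells of the path with source `u`. -/
noncomputable def segment (len : Loc → ℕ) (c : Loc → ℕ → Loc) (u : Loc) : Finset Loc :=
  (Finset.range (len u)).image (c u)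

/-- The sources of nonempty paths. -/
noncomputable def sources (P : Finset Loc) (len : Loc → ℕ) : Finset Loc :=
  P.filter fun u => len u ≠ 0

/-- One step in the graph of paths, using the cells of `S` only. -/
def SegmentStep (P : Finset Loc) (len : Loc → ℕ) (c : Loc → ℕ → Loc) (S : Finset Loc)
    (u v : Loc) : Prop :=
  u ∈ sources P len ∧ segment len c u ⊆ S ∧ c u (len u) = v

theorem mem_segment {len : Loc → ℕ} {c : Loc → ℕ → Loc} {l u : Loc} :
    l ∈ segment len c u ↔ ∃ i < len u, c u i = l := by
  simp [segment]

theorem segment_nonempty {P : Finset Loc} {len : Loc → ℕ} {c : Loc → ℕ → Loc} {u : Loc}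
    (hu : u ∈ sources P len) : (segment len c u).Nonempty :=
  ⟨c u 0, mem_segment.2 ⟨0, Nat.pos_of_ne_zero (Finset.mem_filter.1 hu).2, rfl⟩⟩

namespace Chart

variable {h : Heap Loc} {P : Finset Loc} {len : Loc → ℕ} {c : Loc → ℕ → Loc} {S : Finset Loc}

theorem card_segment (H : Chart h P len c) {u : Loc} (hu : u ∈ P) :
    (segment len c u).card = len u := by
  rw [segment, Finset.card_image_of_injOn, Finset.card_range]
  intro i hi j hj hij
  exact (H.inj u hu u hu i (by simpa using hi) j (by simpa using hj) hij).2

theorem pairwiseDisjoint (H : Chart h P len c) :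
    (sources P len : Set Loc).PairwiseDisjoint (segment len c) := by
  intro u hu v hv hne
  rw [Function.onFun, Finset.disjoint_left]
  intro l hl hl'
  obtain ⟨i, hi, rfl⟩ := mem_segment.1 hl
  obtain ⟨j, hj, hij⟩ := mem_segment.1 hl'
  exact hne (H.inj u (Finset.mem_filter.1 hu).1 v (Finset.mem_filter.1 hv).1 i hi j hj hij.symm).1

theorem segment_subset_dom (H : Chart h P len c) {u : Loc} (hu : u ∈ P) :
    segment len c u ⊆ h.dom := by
  intro l hl
  obtain ⟨i, hi, rfl⟩ := mem_segment.1 hl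
  rw [mem_dom, H.step u hu i hi]
  simp

theorem iter_restrict (H : Chart h P len c) {u : Loc} (hu : u ∈ P) {k : ℕ} (hk : k ≤ len u)
    (hS : ∀ i < k, c u i ∈ S) : (h.restrict S).iter k u = some (c u k) := by
  induction k with
  | zero => rw [H.zero u hu]; rfl
  | succ k ih =>
    rw [iter, ih (by omega) fun i hi => hS i (by omega)]
    rw [Option.bind_some, restrict_toFun, if_pos (hS k (by omega)), H.step u hu k (by omega)]

/-- A walk between locations of `P` is cut at its visits to `P`; between two visits it runs through
a whole path, so all its cells must be in `S`. -/
theorem reach_iff (H : Chart h P len c) {u v : Loc} (hu : u ∈ P) (hv : v ∈ P) :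
    (∃ i, 1 ≤ i ∧ (h.restrict S).iter i u = some v) ↔
      Relation.TransGen (SegmentStep P len c S) u v := by
  constructor
  · rintro ⟨i, hi, hiv⟩
    induction i using Nat.strong_induction_on generalizing u with
    | _ i ih =>
    have hlen : len u ≠ 0 := fun h0 => by
      obtain ⟨n, rfl⟩ : ∃ n, i = n + 1 := ⟨i - 1, by omega⟩
      exact H.dead u hu h0 n v (iter_eq_some_of_restrict hiv) hv
    by_cases hall : ∀ k < min i (len u), c u k ∈ S
    · rcases lt_or_ge i (len u) with hlt | hge
      · rw [H.iter_restrict hu hlt.le fun k hk => hall k (by omega)] at hiv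
        obtain rfl := Option.some.inj hiv
        exact absurd hv (H.inner u hu i hlt (by omega))
      · have hst : SegmentStep P len c S u (c u (len u)) := by
          refine ⟨Finset.mem_filter.2 ⟨hu, hlen⟩, fun l hl => ?_, rfl⟩
          obtain ⟨k, hk, rfl⟩ := mem_segment.1 hl
          exact hall k (by omega)
        have hit := H.iter_restrict hu le_rfl (S := S) fun k hk => hall k (by omega)
        rcases hge.eq_or_lt with heq | hlt
        · rw [← heq, hit] at hiv
          obtain rfl := Option.some.inj hiv
          exact .single hst
        · obtain ⟨j, rfl⟩ : ∃ j, i = len u + j := ⟨i - len u, by omega⟩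
          rw [iter_add, hit, Option.bind_some] at hiv
          exact .head hst (ih j (by omega) (H.last u hu) (by omega) hiv)
    · push Not at hall
      -- The walk gets stuck at the first cell missing from `S`.
      have hex : ∃ k, k < min i (len u) ∧ c u k ∉ S := hall
      obtain ⟨hk, hkS⟩ := Nat.find_spec hex
      have hmin : ∀ j < Nat.find hex, c u j ∈ S := fun j hj => by
        by_contra hc
        exact Nat.find_min hex hj ⟨by omega, hc⟩
      have hit := H.iter_restrict hu (by omega) hmin
      obtain ⟨j, hj⟩ : ∃ j, i = Nat.find hex + 1 + j := ⟨i - (Nat.find hex + 1), by omega⟩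
      rw [hj, iter_add, iter, hit, Option.bind_some, restrict_toFun, if_neg hkS] at hiv
      simp at hiv
  · intro ht
    have hstep : ∀ {a b : Loc}, SegmentStep P len c S a b →
        1 ≤ len a ∧ (h.restrict S).iter (len a) a = some b := by
      rintro a b ⟨ha, hS, rfl⟩
      obtain ⟨haP, hlen⟩ := Finset.mem_filter.1 ha
      exact ⟨by omega, H.iter_restrict haP le_rfl fun i hi => hS (mem_segment.2 ⟨i, hi, rfl⟩)⟩
    clear hv
    induction ht with
    | single hs => exact ⟨_, hstep hs⟩
    | @tail b _ _ hs ih =>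
      obtain ⟨i, hi, hiv⟩ := ih
      refine ⟨i + len b, by omega, ?_⟩
      rw [iter_add, hiv]
      exact (hstep hs).2

theorem pointsTo_iff (H : Chart h P len c) {u v : Loc} (hu : u ∈ P) (hv : v ∈ P) :
    (h.restrict S).toFun u = some v ↔ SegmentStep P len c S u v ∧ len u = 1 := by
  have hz := H.zero u hu
  constructor
  · intro huv
    rw [restrict_toFun] at huv
    split_ifs at huv with hS
    have hlen : len u ≠ 0 := fun h0 => H.dead u hu h0 0 v huv hv
    have h1 : c u 1 = v := by
      have := H.step u hu 0 (by omega)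
      rw [hz, huv] at this
      exact (Option.some.inj this).symm
    have hlen1 : len u = 1 := by
      by_contra hne
      exact H.inner u hu 1 (by omega) one_ne_zero (h1 ▸ hv)
    refine ⟨⟨Finset.mem_filter.2 ⟨hu, hlen⟩, fun l hl => ?_, by rw [hlen1, h1]⟩, hlen1⟩
    obtain ⟨k, hk, rfl⟩ := mem_segment.1 hl
    obtain rfl : k = 0 := by omega
    rwa [hz]
  · rintro ⟨⟨-, hS, hl⟩, hlen⟩
    have hst := H.step u hu 0 (by omega)
    rw [hlen] at hl
    rw [hz, zero_add, hl] at hst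
    rw [restrict_toFun, if_pos (hS (mem_segment.2 ⟨0, by omega, hz⟩)), hst]

end Chart

/-- Two charts have the same sources and the same targets. -/
structure SameGraph (P : Finset Loc) (len len' : Loc → ℕ) (c c' : Loc → ℕ → Loc) : Prop where
  len_eq_zero_iff : ∀ u ∈ P, len u = 0 ↔ len' u = 0
  target_eq : ∀ u ∈ P, c u (len u) = c' u (len' u)

theorem SameGraph.symm {P : Finset Loc} {len len' : Loc → ℕ} {c c' : Loc → ℕ → Loc}
    (hG : SameGraph P len len' c c') : SameGraph P len' len c' c where
  len_eq_zero_iff u hu := (hG.len_eq_zero_iff u hu).symm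
  target_eq u hu := (hG.target_eq u hu).symm

theorem SameGraph.sources_eq {P : Finset Loc} {len len' : Loc → ℕ} {c c' : Loc → ℕ → Loc}
    (hG : SameGraph P len len' c c') : sources P len = sources P len' :=
  Finset.filter_congr fun u hu => not_congr (hG.len_eq_zero_iff u hu)

theorem SameGraph.segmentStep_iff {P : Finset Loc} {len len' : Loc → ℕ} {c c' : Loc → ℕ → Loc}
    (hG : SameGraph P len len' c c') {α : ℕ} {S S' : Finset Loc}
    (hE : BlockEquiv (sources P len) (segment len c) (segment len' c') α S S') (u v : Loc) :
    SegmentStep P len c S u v ↔ SegmentStep P len' c' S' u v := by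
  unfold SegmentStep
  rw [← hG.sources_eq]
  refine and_congr_right fun hu => ?_
  rw [hE.subset_iff u hu, hG.target_eq u (Finset.mem_filter.1 hu).1]

end Heap

/-! ### Equivalent subheaps satisfy the same formulae -/

namespace Formula

open Heap

variable {PVar Loc : Type*}

theorem one_le_size (φ : Formula PVar) : 1 ≤ φ.size := by
  cases φ <;> simp [size]

theorem sat_sep_restrict_iff {s : PVar → Loc} {h : Heap Loc} {S : Finset Loc} (hS : S ⊆ h.dom)
    {φ ψ : Formula PVar} :
    Sat s (h.restrict S) (sep φ ψ) ↔ ∃ S₁ S₂, Disjoint S₁ S₂ ∧ S₁ ∪ S₂ = S ∧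
      Sat s (h.restrict S₁) φ ∧ Sat s (h.restrict S₂) ψ := by
  constructor
  · rintro ⟨h₁, h₂, hd, hu, h1, h2⟩
    obtain ⟨S₁, S₂, hd', hu', rfl, rfl⟩ := (union_eq_restrict_iff hS).1 ⟨hd, hu⟩
    exact ⟨S₁, S₂, hd', hu', h1, h2⟩
  · rintro ⟨S₁, S₂, hd, hu, h1, h2⟩
    obtain ⟨hd, hu⟩ := (union_eq_restrict_iff hS).2 ⟨S₁, S₂, hd, hu, rfl, rfl⟩
    exact ⟨_, _, hd, hu, h1, h2⟩

theorem sat_iff_of_blockEquiv {s : PVar → Loc} {P : Finset Loc} (φ : Formula PVar)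
    (hP : ∀ y ∈ φ.vars, s y ∈ P) {h h' : Heap Loc} {len len' : Loc → ℕ} {c c' : Loc → ℕ → Loc}
    (H : Chart h P len c) (H' : Chart h' P len' c') (hG : SameGraph P len len' c c')
    {S S' : Finset Loc} (hS : S ⊆ h.dom) (hS' : S' ⊆ h'.dom)
    (hE : BlockEquiv (sources P len) (segment len c) (segment len' c') φ.size S S') :
    Sat s (h.restrict S) φ ↔ Sat s (h'.restrict S') φ := by
  induction φ generalizing h h' len len' c c' S S' with
  | eq x y => rfl
  | pointsTo x y =>
    have hx : s x ∈ P := hP x (by simp [vars])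
    have hy : s y ∈ P := hP y (by simp [vars])
    simp only [Sat]
    rw [H.pointsTo_iff hx hy, H'.pointsTo_iff hx hy, hG.segmentStep_iff hE]
    refine and_congr_right fun hst => ?_
    have hst' := (hG.segmentStep_iff hE _ _).2 hst
    have := hE.card_block _ hst'.1 hst'.2.1
    -- Here the threshold for lengths is `1 + 1`, which is what separates length one from greater
    -- lengths.
    rw [H.card_segment hx, H'.card_segment hx] at this
    simp only [CapEq, size] at this
    omega
  | reachPlus x y =>
    have hx : s x ∈ P := hP x (by simp [vars])
    have hy : s y ∈ P := hP y (by simp [vars])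
    simp only [Sat]
    rw [H.reach_iff hx hy, H'.reach_iff hx hy,
      show SegmentStep P len c S = SegmentStep P len' c' S' from
        funext₂ fun u v => propext (hG.segmentStep_iff hE u v)]
  | emp =>
    simp only [Sat]
    rw [dom_restrict hS, dom_restrict hS']
    constructor
    · rintro rfl
      exact BlockEquiv.eq_empty le_rfl (fun u hu => segment_nonempty hu) hE
    · rintro rfl
      refine BlockEquiv.eq_empty le_rfl (fun u hu => segment_nonempty (P := P) ?_) hE.symm
      rwa [← hG.sources_eq]
  | neg φ ih =>
    simp only [Sat]
    exact not_congr (ih hP H H' hG hS hS' (hE.mono (by simp [size])))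
  | and φ ψ ihφ ihψ =>
    simp only [Sat]
    refine and_congr
      (ihφ (fun y hy => hP y (Or.inl hy)) H H' hG hS hS' (hE.mono (by simp only [size]; omega)))
      (ihψ (fun y hy => hP y (Or.inr hy)) H H' hG hS hS' (hE.mono (by simp only [size]; omega)))
  | sep φ ψ ihφ ihψ =>
    -- Stated for arbitrary charts so that the symmetry of the invariant yields the converse.
    have one_dir : ∀ {h h' : Heap Loc} {len len' : Loc → ℕ} {c c' : Loc → ℕ → Loc},
        Chart h P len c → Chart h' P len' c' → SameGraph P len len' c c' →
        ∀ {S S' : Finset Loc}, S ⊆ h.dom → S' ⊆ h'.dom →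
        BlockEquiv (sources P len) (segment len c) (segment len' c') (sep φ ψ).size S S' →
        Sat s (h.restrict S) (sep φ ψ) → Sat s (h'.restrict S') (sep φ ψ) := by
      intro h h' len len' c c' H H' hG S S' hS hS' hE hsat
      obtain ⟨S₁, S₂, hd, rfl, h1, h2⟩ := (sat_sep_restrict_iff hS).1 hsat
      obtain ⟨T₁, T₂, hd', rfl, hE₁, hE₂⟩ :=
        (hE.mono (γ := φ.size + ψ.size) (by simp [size])).exists_split H.pairwiseDisjoint
          (hG.sources_eq ▸ H'.pairwiseDisjoint) φ.one_le_size ψ.one_le_size hd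
      refine (sat_sep_restrict_iff hS').2 ⟨T₁, T₂, hd', rfl, ?_, ?_⟩
      · exact (ihφ (fun y hy => hP y (Or.inl hy)) H H' hG (Finset.union_subset_left hS)
          (Finset.union_subset_left hS') hE₁).1 h1
      · exact (ihψ (fun y hy => hP y (Or.inr hy)) H H' hG (Finset.union_subset_right hS)
          (Finset.union_subset_right hS') hE₂).1 h2
    exact ⟨one_dir H H' hG hS hS' hE, one_dir H' H hG.symm hS' hS (hG.sources_eq ▸ hE.symm)⟩

end Formula

/-! ### Existence of a chart, and shrinking the heap -/

namespace Heap

variable {Loc : Type*}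

/-- The cells of `h` that are reachable from `V`. -/
noncomputable def reachableDom (h : Heap Loc) (V : Finset Loc) : Finset Loc :=
  h.dom.filter fun l => ∃ v ∈ V, ∃ n, h.iter n v = some l

/-- The locations with two predecessors that are reachable from `V`. -/
noncomputable def branchPoints (h : Heap Loc) (V : Finset Loc) : Finset Loc :=
  ((h.reachableDom V).image fun l => (h.toFun l).getD l).filter fun l =>
    ∃ a ∈ h.reachableDom V, ∃ b ∈ h.reachableDom V,
      a ≠ b ∧ h.toFun a = some l ∧ h.toFun b = some l

/-- With `D` the reachable cells and `f` the successor map, every cell of `D` is in `V` or in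
`f(D)`, so `|D| ≤ |V| + |f(D)|`. Summing fibres over `f(D)`, where a branch point has at least two
preimages, gives `|f(D)| + |branch points| ≤ |D|`. -/
theorem card_branchPoints_le (h : Heap Loc) (V : Finset Loc) :
    (h.branchPoints V).card ≤ V.card := by
  set D := h.reachableDom V with hD
  set f : Loc → Loc := fun l => (h.toFun l).getD l with hf
  have hsub : D ⊆ V ∪ D.image f := by
    intro l hl
    obtain ⟨hdom, v, hv, n, hn⟩ := Finset.mem_filter.1 hl
    cases n with
    | zero => exact Finset.mem_union_left _ (Option.some.inj hn ▸ hv)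
    | succ n =>
      obtain ⟨a, ha, hal⟩ := Option.bind_eq_some_iff.1 hn
      refine Finset.mem_union_right _ (Finset.mem_image.2 ⟨a, ?_, by simp [hf, hal]⟩)
      exact Finset.mem_filter.2 ⟨mem_dom.2 (by simp [hal]), v, hv, n, ha⟩
  have h1 : D.card ≤ V.card + (D.image f).card :=
    (Finset.card_le_card hsub).trans (Finset.card_union_le _ _)
  have h2 : (D.image f).card + (h.branchPoints V).card ≤ D.card := by
    rw [Finset.card_eq_sum_card_image f D, branchPoints, Finset.card_filter, Finset.card_eq_sum_ones,
      ← Finset.sum_add_distrib]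
    refine Finset.sum_le_sum fun l hl => ?_
    split_ifs with hb
    · obtain ⟨a, ha, b, hb, hne, hal, hbl⟩ := hb
      have : 1 < (D.filter fun x => f x = l).card :=
        Finset.one_lt_card.2 ⟨a, by simp [ha, hf, hal, D], b, by simp [hb, hf, hbl, D], hne⟩
      omega
    · obtain ⟨a, ha, hal⟩ := Finset.mem_image.1 hl
      have : 0 < (D.filter fun x => f x = l).card :=
        Finset.card_pos.2 ⟨a, Finset.mem_filter.2 ⟨ha, hal⟩⟩
      omega
  omega

/-- Follow `h` from `u` until the first return to `P`. Two paths that share a cell are traced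
backwards: either they agree down to their sources, or they merge at a branch point, which is in `P`
and cannot be interior. -/
theorem exists_chart (h : Heap Loc) (V : Finset Loc) :
    ∃ len c, Chart h (V ∪ h.branchPoints V) len c := by
  set P := V ∪ h.branchPoints V with hP
  have hreach : ∀ u ∈ P, ∃ v ∈ V, ∃ n, h.iter n v = some u := by
    intro u hu
    rcases Finset.mem_union.1 hu with hu | hu
    · exact ⟨u, hu, 0, rfl⟩
    · obtain ⟨-, a, ha, -, -, -, hau, -⟩ := Finset.mem_filter.1 hu
      obtain ⟨-, v, hv, n, hn⟩ := Finset.mem_filter.1 ha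
      exact ⟨v, hv, n + 1, by rw [iter, hn]; exact hau⟩
  have hlen : ∀ u, ∃ n, (n = 0 → ∀ k v, h.iter (k + 1) u = some v → v ∉ P) ∧
      (n ≠ 0 → ∃ v ∈ P, h.iter n u = some v) ∧
      ∀ k < n, k ≠ 0 → ∀ v, h.iter k u = some v → v ∉ P := by
    intro u
    by_cases hex : ∃ n, n ≠ 0 ∧ ∃ v ∈ P, h.iter n u = some v
    · refine ⟨Nat.find hex, fun h0 => absurd h0 (Nat.find_spec hex).1,
        fun _ => (Nat.find_spec hex).2, fun k hk hk0 v hv hvP => ?_⟩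
      exact Nat.find_min hex hk ⟨hk0, v, hvP, hv⟩
    · exact ⟨0, fun _ k v hv hvP => hex ⟨k + 1, by omega, v, hvP, hv⟩, by simp, by simp⟩
  choose len hdead hlast hinner using hlen
  have hsome : ∀ u, ∀ i ≤ len u, h.iter i u = some ((h.iter i u).getD u) := by
    intro u i hi
    rcases Nat.eq_zero_or_pos i with rfl | hpos
    · rfl
    obtain ⟨v, -, hv⟩ := hlast u (by omega)
    obtain ⟨j, hj⟩ : ∃ j, len u = i + j := ⟨len u - i, by omega⟩
    rw [hj, iter_add] at hv
    obtain ⟨a, ha, -⟩ := Option.bind_eq_some_iff.1 hv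
    simp [ha]
  have hstep : ∀ u, ∀ i < len u,
      h.toFun ((h.iter i u).getD u) = some ((h.iter (i + 1) u).getD u) := by
    intro u i hi
    have h1 := hsome u (i + 1) hi
    rw [iter, hsome u i hi.le, Option.bind_some] at h1
    rw [h1, iter, hsome u i hi.le, Option.bind_some]
    simp
  have hinn : ∀ u, ∀ i < len u, i ≠ 0 → (h.iter i u).getD u ∉ P := fun u i hi hi0 =>
    hinner u i hi hi0 _ (hsome u i hi.le)
  have hmem : ∀ u ∈ P, ∀ i < len u, (h.iter i u).getD u ∈ h.reachableDom V := by
    intro u hu i hi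
    obtain ⟨v, hv, n, hn⟩ := hreach u hu
    refine Finset.mem_filter.2 ⟨mem_dom.2 (by rw [hstep u i hi]; simp), v, hv, n + i, ?_⟩
    rw [iter_add, hn]
    exact hsome u i hi.le
  -- The default `u` is never used for `i ≤ len u`, where the iterate is defined.
  refine ⟨len, fun u i => (h.iter i u).getD u, fun u _ => rfl, fun u _ => hstep u, fun u hu => ?_,
    fun u _ => hinn u, fun u hu v hv i => ?_, fun u _ => hdead u⟩
  · by_cases h0 : len u = 0
    · rw [h0]; exact hu
    · obtain ⟨v, hvP, hv⟩ := hlast u h0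
      simpa [hv] using hvP
  · induction i with
    | zero =>
      intro hi j hj hij
      by_cases hj0 : j = 0
      · subst hj0; exact ⟨hij, rfl⟩
      · exact absurd (hij ▸ hu) (hinn v j hj hj0)
    | succ i ih =>
      intro hi j hj hij
      cases j with
      | zero => exact absurd (hij ▸ hv) (hinn u (i + 1) hi (by omega))
      | succ j =>
        by_cases heq : (h.iter i u).getD u = (h.iter j v).getD v
        · obtain ⟨h1, h2⟩ := ih (by omega) j (by omega) heq
          exact ⟨h1, by rw [h2]⟩
        · refine absurd (Finset.mem_union_right _ ?_) (hinn u (i + 1) hi (by omega))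
          have h1 := hstep u i (by omega)
          have h2 := hstep v j (by omega)
          have hm := hmem u hu i (by omega)
          rw [← hij] at h2
          exact Finset.mem_filter.2 ⟨Finset.mem_image.2 ⟨_, hm, by rw [h1]; rfl⟩,
            _, hm, _, hmem v hv j (by omega), heq, h1, h2⟩

theorem Chart.remainder_dom {h : Heap Loc} {P : Finset Loc} {len : Loc → ℕ} {c : Loc → ℕ → Loc}
    (H : Chart h P len c) :
    remainder (sources P len) (segment len c) h.dom =
      h.dom \ (sources P len).biUnion (segment len c) := by
  rw [remainder, fullBlocks, Finset.filter_true_of_mem]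
  exact fun u hu => H.segment_subset_dom (Finset.mem_filter.1 hu).1

theorem Chart.exists_small [Infinite Loc] {h : Heap Loc} {P : Finset Loc} {len : Loc → ℕ}
    {c : Loc → ℕ → Loc} (H : Chart h P len c) (α : ℕ) :
    ∃ h' len' c', Chart h' P len' c' ∧ SameGraph P len len' c c' ∧
      BlockEquiv (sources P len) (segment len c) (segment len' c') α h.dom h'.dom ∧
      h'.dom.card ≤ P.card * (α + 1) + α := by
  set R := h.dom \ (sources P len).biUnion (segment len c) with hR
  obtain ⟨R', hR'R, hR'⟩ : ∃ R' ⊆ R, R'.card = min R.card α :=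
    Finset.exists_subset_card_eq (by omega)
  -- A fresh sink for the retained anonymous cells: unallocated in the new heap and outside `P`, so
  -- these cells create no new path to `P`.
  obtain ⟨d, hd⟩ := Infinite.exists_notMem_finset (h.dom ∪ P)
  rw [Finset.mem_union, not_or] at hd
  set len' : Loc → ℕ := fun u => min (len u) (α + 1) with hlen'
  -- The shortened path keeps its first cells, and the last of them is redirected to the old target.
  set c' : Loc → ℕ → Loc := fun u i => if i = len' u then c u (len u) else c u i with hc'
  have hle : ∀ u, len' u ≤ len u := fun u => min_le_left _ _
  have hlt : ∀ u, ∀ i < len' u, c' u i = c u i := fun u i hi => if_neg hi.ne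
  have hlast : ∀ u, c' u (len' u) = c u (len u) := fun u => if_pos rfl
  have hz : ∀ u, len u = 0 ↔ len' u = 0 := fun u => by simp only [hlen']; omega
  have hnR : ∀ u ∈ P, ∀ i < len' u, c' u i ∉ R := by
    intro u hu i hi hc
    rw [hlt u i hi] at hc
    have hi' := hi.trans_le (hle u)
    exact (Finset.mem_sdiff.1 hc).2 (Finset.mem_biUnion.2
      ⟨u, Finset.mem_filter.2 ⟨hu, by omega⟩, mem_segment.2 ⟨i, hi', rfl⟩⟩)
  have hinj : ∀ u ∈ P, ∀ v ∈ P, ∀ i < len' u, ∀ j < len' v, c' u i = c' v j → u = v ∧ i = j := by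
    intro u hu v hv i hi j hj hij
    rw [hlt u i hi, hlt v j hj] at hij
    exact H.inj u hu v hv i (hi.trans_le (hle u)) j (hj.trans_le (hle v)) hij
  set C := P.biUnion (segment len' c') with hC
  have hCmem : ∀ l, l ∈ C ↔ ∃ u ∈ P, ∃ i < len' u, c' u i = l := fun l => by
    simp [hC, mem_segment]
  obtain ⟨g, hg⟩ : ∃ g : Loc → Loc, (∀ u ∈ P, ∀ i < len' u, g (c' u i) = c' u (i + 1)) ∧
      ∀ l ∉ C, g l = d := by
    have : ∀ l, ∃ m, (∀ u ∈ P, ∀ i < len' u, c' u i = l → m = c' u (i + 1)) ∧ (l ∉ C → m = d) := by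
      intro l
      by_cases hl : l ∈ C
      · obtain ⟨u, hu, i, hi, rfl⟩ := (hCmem l).1 hl
        refine ⟨c' u (i + 1), fun v hv j hj hij => ?_, fun hn => absurd hl hn⟩
        obtain ⟨rfl, rfl⟩ := hinj v hv u hu j hj i hi hij
        rfl
      · refine ⟨d, fun u hu i hi hl' => absurd ((hCmem l).2 ⟨u, hu, i, hi, hl'⟩) hl, fun _ => rfl⟩
    choose g hg using this
    exact ⟨g, fun u hu i hi => (hg _).1 u hu i hi rfl, fun l hl => (hg l).2 hl⟩
  let h' : Heap Loc :=
    { toFun := fun l => if l ∈ C ∪ R' then some (g l) else none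
      finite_dom := (C ∪ R').finite_toSet.subset fun l hl => by
        by_contra hc
        exact hl (if_neg hc) }
  have hfun : ∀ l, h'.toFun l = if l ∈ C ∪ R' then some (g l) else none := fun l => rfl
  have hdom : h'.dom = C ∪ R' := by
    ext l
    rw [mem_dom, hfun]
    by_cases hl : l ∈ C ∪ R' <;> simp [hl]
  have hCR : Disjoint C R' := by
    rw [Finset.disjoint_left]
    intro l hl hlR
    obtain ⟨u, hu, i, hi, rfl⟩ := (hCmem l).1 hl
    exact hnR u hu i hi (hR'R hlR)
  have hCdom : C ⊆ h.dom := by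
    intro l hl
    obtain ⟨u, hu, i, hi, rfl⟩ := (hCmem l).1 hl
    rw [hlt u i hi, mem_dom, H.step u hu i (hi.trans_le (hle u))]
    simp
  have H' : Chart h' P len' c' := by
    refine ⟨fun u hu => ?_, fun u hu i hi => ?_, fun u hu => ?_, fun u hu i hi hi0 => ?_, hinj,
      fun u hu h0 n v hv => ?_⟩
    · rcases Nat.eq_zero_or_pos (len' u) with h0 | hpos
      · have := hlast u
        rwa [h0, (hz u).2 h0, H.zero u hu] at this
      · rw [hlt u 0 hpos, H.zero u hu]
    · rw [hfun, if_pos (Finset.mem_union_left _ ((hCmem _).2 ⟨u, hu, i, hi, rfl⟩)), hg.1 u hu i hi]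
    · rw [hlast]; exact H.last u hu
    · rw [hlt u i hi]; exact H.inner u hu i (hi.trans_le (hle u)) hi0
    · have huC : u ∉ C := by
        intro huC
        obtain ⟨w, hw, i, hi, rfl⟩ := (hCmem u).1 huC
        have hi' := hi.trans_le (hle w)
        rcases Nat.eq_zero_or_pos i with rfl | hpos
        · rw [hlt w 0 hi, H.zero w hw] at h0
          omega
        · rw [hlt w i hi] at hu
          exact H.inner w hw i hi' (by omega) hu
      have hdn : h'.toFun d = none := by
        rw [hfun, if_neg]
        rw [Finset.mem_union, not_or]
        exact ⟨fun hc => hd.1 (hCdom hc), fun hc => hd.1 (Finset.mem_sdiff.1 (hR'R hc)).1⟩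
      rw [add_comm, iter_add, iter_one, hfun, hg.2 u huC] at hv
      split_ifs at hv with huR
      · rw [Option.bind_some] at hv
        cases n with
        | zero => exact Option.some.inj hv ▸ hd.2
        | succ n =>
          rw [add_comm, iter_add, iter_one, hdn] at hv
          simp at hv
      · simp at hv
  have hG : SameGraph P len len' c c' := ⟨fun u _ => hz u, fun u _ => (hlast u).symm⟩
  have hrem : remainder (sources P len) (segment len' c') h'.dom = R' := by
    rw [hG.sources_eq, H'.remainder_dom, hdom]
    have : (sources P len').biUnion (segment len' c') = C := by
      ext l
      rw [hCmem, Finset.mem_biUnion]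
      constructor
      · rintro ⟨u, hu, hl⟩
        exact ⟨u, (Finset.mem_filter.1 hu).1, mem_segment.1 hl⟩
      · rintro ⟨u, hu, i, hi, hl⟩
        exact ⟨u, Finset.mem_filter.2 ⟨hu, by omega⟩, mem_segment.2 ⟨i, hi, hl⟩⟩
    rw [this, Finset.union_sdiff_cancel_left hCR]
  refine ⟨h', len', c', H', hG, ⟨fun u hu => ?_, fun u hu _ => ?_, ?_⟩, ?_⟩
  · have hu' := (Finset.mem_filter.1 hu).1
    exact iff_of_true (H.segment_subset_dom hu') (H'.segment_subset_dom hu')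
  · have hu' := (Finset.mem_filter.1 hu).1
    rw [H.card_segment hu', H'.card_segment hu']
    simp only [CapEq, hlen']
    omega
  · rw [hrem, H.remainder_dom, hR', ← hR]
    unfold CapEq
    omega
  · rw [hdom]
    refine (Finset.card_union_le _ _).trans (add_le_add ?_ (by omega))
    refine Finset.card_biUnion_le_card_mul _ _ _ fun u hu => ?_
    rw [H'.card_segment hu]
    exact min_le_right _ _

end Heap

end SepLogic

theorem mainTheorem4 {PVar Loc : Type*} [Infinite Loc] (q : ℕ) (x : Fin q → PVar)
    (φ : SepLogic.Formula PVar) (hvars : φ.vars ⊆ Set.range x)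
    (hsat : φ.Satisfiable Loc) :
    ∃ (s : PVar → Loc) (h : SepLogic.Heap Loc),
      SepLogic.Formula.Sat s h φ ∧
        h.dom.card ≤ (q ^ 2 + q) * (φ.size + 1) + φ.size := by
  classical
  obtain ⟨s, h, hsat⟩ := hsat
  set V : Finset Loc := Finset.univ.image fun i => s (x i) with hV
  obtain ⟨len, c, H⟩ := h.exists_chart V
  obtain ⟨h', len', c', H', hG, hE, hcard⟩ := H.exists_small φ.size
  refine ⟨s, h', ?_, hcard.trans ?_⟩
  · rw [← h'.restrict_dom]
    refine (SepLogic.Formula.sat_iff_of_blockEquiv φ (fun y hy => ?_) H H' hG subset_rfl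
      subset_rfl hE).1 (by rwa [h.restrict_dom])
    obtain ⟨i, rfl⟩ := hvars hy
    exact Finset.mem_union_left _ (Finset.mem_image.2 ⟨i, Finset.mem_univ i, rfl⟩)
  · gcongr
    have h1 : V.card ≤ q := Finset.card_image_le.trans (by simp)
    refine (Finset.card_union_le _ _).trans ?_
    have h2 := h.card_branchPoints_le V
    have h3 : q ≤ q ^ 2 := Nat.le_self_pow two_ne_zero q
    omega
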